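/- Let $n\ge 5$ be odd. (a) There exists an irregular (i.e. non-degenerate and not regular) $n$-simplex $S\subset\mathbb R^n$ whose largest hyperplane section is not a facet: among all affine hyperplanes $H\subset\mathbb R^n$ there is one for which the $(n-1)$-dimensional volume of $S\cap H$ is maximal, and this maximal volume is strictly larger than the volume of every facet of $S$. (b) An explicit example is a compressed regular simplex. Let $e_1,\dots,e_{n+1}$ be the standard basis of $\mathbb R^{n+1}$, let $u=(1,\dots,1,-1,\dots,-1)\in\mathbb R^{n+1}$ with $\frac{n+1}{2}$ entries equal to $1$ and $\frac{n+1}{2}$ entries equal to $-1$, and for $-\frac1{n+1}<\delta\le 0$ let $S(\delta)\subset\mathbb R^{n+1}$ be the convex hull of the points $e_j+\delta\langle u,e_j\rangle u$, $j=1,\dots,n+1$. (Thus $S(0)$ is the regular simplex.) Then $S(\delta)$ is a non-degenerate $n$-simplex, and for every facet $F_i(\delta)$ of $S(\delta)$, with $H_u=\{x:\langle u,x\rangle=0\}$, $$\lim_{\delta\to-\frac1{n+1}^{+}}\frac{\operatorname{vol}_{n-1}(H_u\cap S(\delta))}{\operatorname{vol}_{n-1}(F_i(\delta))}=\frac{(n+1)\,(n-1)!}{2\,((n-1)!!)^2}>1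 .$$ Consequently, for all $\delta>-\frac1{n+1}$ sufficiently close to $-\frac1{n+1}$, the simplex $S(\delta)$ is irregular and its largest hyperplane section (within its $n$-dimensional affine hull) is not a facet. -/

import Mathlib

open Filter Topology MeasureTheory
open scoped Nat

noncomputable section

namespace SimplexSection

/-- The facet of the simplex `S` opposite to the vertex `i`: the convex hull of the other vertices. -/
def facet {N n : ℕ} (S : Affine.Simplex ℝ (EuclideanSpace ℝ (Fin N)) n) (i : Fin (n + 1)) :
    Set (EuclideanSpace ℝ (Fin N)) :=
  convexHull ℝ (S.points '' {i}ᶜ)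

/-- `H` is a hyperplane of the `n`-dimensional affine hull of the `n`-simplex `S`.
For an `n`-simplex in `ℝⁿ` these are all the affine hyperplanes. -/
def IsHyperplane {N n : ℕ} (S : Affine.Simplex ℝ (EuclideanSpace ℝ (Fin N)) n)
    (H : AffineSubspace ℝ (EuclideanSpace ℝ (Fin N))) : Prop :=
  H ≤ affineSpan ℝ (Set.range S.points) ∧ (H : Set (EuclideanSpace ℝ (Fin N))).Nonempty ∧
    Module.finrank ℝ H.direction + 1 = n

/-- The largest hyperplane section of `S` is not a facet: a section of maximal
`(n-1)`-dimensional volume exists, and every facet has strictly smaller volume.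
(`μHE[k]` is the Hausdorff measure, scaled to be the `k`-dimensional Lebesgue volume.) -/
def LargestSectionNotFacet {N n : ℕ} (S : Affine.Simplex ℝ (EuclideanSpace ℝ (Fin N)) n) : Prop :=
  ∃ H : AffineSubspace ℝ (EuclideanSpace ℝ (Fin N)), IsHyperplane S H ∧
    (∀ H' : AffineSubspace ℝ (EuclideanSpace ℝ (Fin N)), IsHyperplane S H' →
      μHE[n - 1] (S.closedInterior ∩ H') ≤ μHE[n - 1] (S.closedInterior ∩ H)) ∧
    ∀ i : Fin (n + 1), μHE[n - 1] (facet S i) < μHE[n - 1] (S.closedInterior ∩ H)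

/-- The vector `(1,…,1,-1,…,-1)` of `ℝⁿ⁺¹`, for odd `n` with `(n+1)/2` entries of either sign. -/
def normal (n : ℕ) : EuclideanSpace ℝ (Fin (n + 1)) :=
  WithLp.toLp 2 fun i => if 2 * (i : ℕ) < n + 1 then 1 else -1

/-- The linear map `I + δ u uᵀ` with `u = (1,…,1,-1,…,-1)`. It fixes the hyperplane orthogonal
to `u` and scales the direction `u` by `1 + (n+1)δ` (for odd as for even `n`, `‖u‖² = n + 1`). -/
def compress (n : ℕ) (δ : ℝ) (x : EuclideanSpace ℝ (Fin (n + 1))) :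
    EuclideanSpace ℝ (Fin (n + 1)) :=
  x + (δ * inner ℝ (normal n) x) • normal n

/-- The intersection of a simplex in `ℝⁿ⁺¹` with the linear hyperplane orthogonal to
`(1,…,1,-1,…,-1)`. -/
def centralSection {n : ℕ} (S : Affine.Simplex ℝ (EuclideanSpace ℝ (Fin (n + 1))) n) :
    Set (EuclideanSpace ℝ (Fin (n + 1))) :=
  S.closedInterior ∩ {x | inner ℝ (normal n) x = 0}

end SimplexSection

end

noncomputable section

namespace SimplexSection


/-! Write `n = 2k + 1`. The map `I + δuuᵀ` is the identity on `u^⊥`, so the section of `S(δ)` by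
`u^⊥` does not depend on `δ`: it is a product of two regular `k`-simplices, of volume
`(k+1)((1/2)^k/k!)²` (`centralSection_volume`). The facets do shrink: the Gram determinant of their
edges is a quadratic polynomial in `δ` tending to `1` (`facet_volume`, `tendsto_facetGram`), so
their volume tends to `1/(2k)!`. The limit ratio is `(k+1)·C(2k,k)/4^k`, which exceeds `1` from `k =
2` on (`one_lt_limitRatio`).

A section of maximal volume exists by compactness and upper semicontinuity
(`exists_largest_section`), so one section beating every facet is enough. For (a), the example is
carried isometrically into `ℝⁿ` (`exists_map_eq`, `LargestSectionNotFacet.of_map`). -/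

/-! ### Volumes of simplices from Gram determinants. -/

/-- The corner simplex with legs of length `t`. -/
def cornerSimplex (ι : Type*) [Fintype ι] (t : ℝ) : Set (ι → ℝ) :=
  {x | (∀ i, 0 ≤ x i) ∧ ∑ i, x i ≤ t}

theorem measurableSet_cornerSimplex (ι : Type*) [Fintype ι] (t : ℝ) :
    MeasurableSet (cornerSimplex ι t) := by
  have : IsClosed (cornerSimplex ι t) := by
    have h : cornerSimplex ι t = (⋂ i, {x : ι → ℝ | 0 ≤ x i}) ∩ {x | ∑ i, x i ≤ t} := by
      ext x; simp [cornerSimplex]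
    rw [h]
    refine IsClosed.inter (isClosed_iInter fun i => ?_) ?_
    · exact isClosed_le continuous_const (continuous_apply i)
    · exact isClosed_le (by fun_prop) continuous_const
  exact this.measurableSet

theorem volume_cornerSimplex_fin (k : ℕ) {t : ℝ} (ht : 0 ≤ t) :
    volume (cornerSimplex (Fin k) t) = ENNReal.ofReal (t ^ k / (k ! : ℕ)) := by
  induction k generalizing t with
  | zero =>
    have : cornerSimplex (Fin 0) t = Set.univ := by
      ext x; simp [cornerSimplex, ht]
    rw [this, volume_pi, Measure.pi_of_empty]; simp
  | succ k ih =>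
    have hmp := (volume_preserving_piFinSuccAbove (fun _ : Fin (k + 1) => ℝ) 0).symm
    rw [← hmp.measure_preimage_equiv, Measure.volume_eq_prod,
      Measure.prod_apply ((measurableSet_cornerSimplex _ t).preimage (MeasurableEquiv.measurable _))]
    -- Fubini: the slice at first coordinate `x ∈ [0, t]` is a corner simplex with legs `t - x`; all
    -- other slices are empty.
    have hs : ∀ x : ℝ, volume (Prod.mk x ⁻¹'
        ((MeasurableEquiv.piFinSuccAbove (fun _ : Fin (k + 1) => ℝ) 0).symm ⁻¹'
          cornerSimplex (Fin (k + 1)) t)) =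
        (Set.Icc 0 t).indicator (fun x => ENNReal.ofReal ((t - x) ^ k / (k ! : ℕ))) x := by
      intro x
      by_cases hx : x ∈ Set.Icc 0 t
      · rw [Set.indicator_of_mem hx, ← ih (sub_nonneg.2 hx.2)]
        congr 1
        ext y
        simp [cornerSimplex, Fin.forall_fin_succ, Fin.sum_univ_succ, hx.1, le_sub_iff_add_le']
      · rw [Set.indicator_of_notMem hx]
        convert! measure_empty (μ := volume)
        ext y
        simp only [Set.mem_preimage, cornerSimplex, Set.mem_empty_iff_false, iff_false]
        rintro ⟨h1, h2⟩
        rw [Fin.sum_univ_succ] at h2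
        have h0 := h1 0
        have h3 : 0 ≤ ∑ i : Fin k, (MeasurableEquiv.piFinSuccAbove (fun _ : Fin (k + 1) => ℝ) 0).symm
          (x, y) i.succ := Finset.sum_nonneg fun i _ => h1 _
        simp at h0 h2 h3
        exact hx ⟨h0, by linarith⟩
    simp_rw [hs]
    rw [lintegral_indicator measurableSet_Icc, ← ofReal_integral_eq_lintegral_ofReal]
    · congr 1
      rw [integral_Icc_eq_integral_Ioc, ← intervalIntegral.integral_of_le ht,
        intervalIntegral.integral_div, intervalIntegral.integral_comp_sub_left (fun x => x ^ k)]
      simp [Nat.factorial_succ]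
      field_simp
    · exact (Continuous.continuousOn (by fun_prop)).integrableOn_Icc
    · refine (ae_restrict_iff' measurableSet_Icc).2 (ae_of_all _ fun x hx => ?_)
      have := sub_nonneg.2 hx.2
      simp only [Pi.zero_apply]
      positivity

theorem volume_cornerSimplex (ι : Type*) [Fintype ι] {t : ℝ} (ht : 0 ≤ t) :
    volume (cornerSimplex ι t) =
      ENNReal.ofReal (t ^ Fintype.card ι / ((Fintype.card ι)! : ℕ)) := by
  rw [← volume_cornerSimplex_fin _ ht]
  have e := (Fintype.equivFin ι).symm
  rw [← (volume_measurePreserving_piCongrLeft (fun _ : ι => ℝ) e).measure_preimage_equiv]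
  congr 1
  ext x
  simp only [cornerSimplex, Set.mem_preimage, Set.mem_ofPred_eq]
  rw [← e.sum_comp, ← e.forall_congr_right]
  simp [MeasurableEquiv.piCongrLeft, Equiv.piCongrLeft_apply_apply]

variable {V : Type*} [NormedAddCommGroup V] [InnerProductSpace ℝ V] [MeasurableSpace V]
  [BorelSpace V]

/-- The volume of the image of a set of coefficients under a linear combination, in terms of the
Gram determinant. -/
theorem euclideanHausdorffMeasure_image_linearCombination {ι : Type*} [Fintype ι] [DecidableEq ι]
    {d : ℕ} (hd : Fintype.card ι = d) (p : V) (v : ι → V) {s : Set (ι → ℝ)}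
    (hs : MeasurableSet s) :
    μHE[d] ((fun w : ι → ℝ => p + ∑ i, w i • v i) '' s) =
      ENNReal.ofReal √(Matrix.gram ℝ v).det * volume s := by
  subst hd
  let f : EuclideanSpace ℝ ι →ₗ[ℝ] V :=
    (Fintype.linearCombination ℝ v) ∘ₗ (WithLp.linearEquiv 2 ℝ (ι → ℝ)).toLinearMap
  have hf : ∀ x, f x = ∑ i, x i • v i := fun x => by
    simp [f, Fintype.linearCombination_apply]
  have hset : (fun w : ι → ℝ => p + ∑ i, w i • v i) '' s =
      (fun y => p + y) '' (f '' (WithLp.ofLp ⁻¹' s)) := by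
    rw [Set.image_image]
    ext y
    constructor
    · rintro ⟨w, hw, rfl⟩
      exact ⟨WithLp.toLp 2 w, hw, by simp [hf]⟩
    · rintro ⟨w, hw, rfl⟩
      exact ⟨w.ofLp, hw, by simp [hf]⟩
  have hvol : volume (WithLp.ofLp ⁻¹' s : Set (EuclideanSpace ℝ ι)) = volume s :=
    (PiLp.volume_preserving_ofLp ι).measure_preimage hs.nullMeasurableSet
  have hdet : f.normDet = √(Matrix.gram ℝ v).det := by
    have h := f.normDet_sq_eq_det_gram (EuclideanSpace.basisFun ι ℝ)
    have h2 : (fun i => f (EuclideanSpace.basisFun ι ℝ i)) = v := by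
      ext i; simp [hf]
    rw [h2] at h
    rw [← h]
    exact (Real.sqrt_sq f.normDet_nonneg).symm
  have hfin := f.euclideanHausdorffMeasure_image_eq_normDet_mul_volume (WithLp.ofLp ⁻¹' s)
  rw [finrank_euclideanSpace] at hfin
  rw [hset, (isometry_add_left p).euclideanHausdorffMeasure_image, hfin, hvol, hdet]

theorem convex_cornerSimplex (ι : Type*) [Fintype ι] (t : ℝ) : Convex ℝ (cornerSimplex ι t) := by
  rintro x ⟨hx, hx'⟩ y ⟨hy, hy'⟩ a b ha hb hab
  refine ⟨fun i => ?_, ?_⟩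
  · have := hx i
    have := hy i
    simp only [Pi.add_apply, Pi.smul_apply, smul_eq_mul]
    positivity
  · simp only [Pi.add_apply, Pi.smul_apply, smul_eq_mul, Finset.sum_add_distrib,
      ← Finset.mul_sum]
    exact (add_le_add (mul_le_mul_of_nonneg_left hx' ha)
      (mul_le_mul_of_nonneg_left hy' hb)).trans_eq (by rw [← add_mul, hab, one_mul])

/-- The volume of a simplex with a vertex `p` in terms of the Gram determinant of its edges at
`p`. -/
theorem euclideanHausdorffMeasure_convexHull {ι : Type*} [Fintype ι] [DecidableEq ι] {d : ℕ}
    (hd : Fintype.card ι = d) (p : V) (v : ι → V) :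
    μHE[d] (convexHull ℝ (insert p (Set.range fun i => p + v i))) =
      ENNReal.ofReal (√(Matrix.gram ℝ v).det / (d ! : ℕ)) := by
  have hset : convexHull ℝ (insert p (Set.range fun i => p + v i)) =
      (fun w : ι → ℝ => p + ∑ i, w i • v i) '' cornerSimplex ι 1 := by
    apply subset_antisymm
    · refine convexHull_min ?_ ?_
      · rintro _ (rfl | ⟨i, rfl⟩)
        · exact ⟨0, by simp [cornerSimplex], by simp⟩
        · exact ⟨Pi.single i 1, ⟨fun j => by
            by_cases h : j = i <;> simp [h], by simp⟩, by simp [Pi.single_apply]⟩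
      · have := (((convex_cornerSimplex ι 1).linear_image
          (Fintype.linearCombination ℝ v)).translate p)
        rw [Set.image_image] at this
        simpa only [Fintype.linearCombination_apply] using this
    · rintro _ ⟨x, ⟨hx, hx'⟩, rfl⟩
      -- Barycentric coordinates: the slack `1 - ∑ x i` is the weight of the vertex `p`.
      let w : Option ι → ℝ := fun o => o.elim (1 - ∑ i, x i) x
      let z : Option ι → V := fun o => o.elim p (fun i => p + v i)
      have hc := (convex_convexHull ℝ (insert p (Set.range fun i => p + v i))).sum_mem
        (t := Finset.univ) (w := w) (z := z) ?_ ?_ ?_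
      · convert! hc using 1
        simp only [Fintype.sum_option, w, z, Option.elim, smul_add, Finset.sum_add_distrib,
          ← Finset.sum_smul, sub_smul, one_smul]
        abel
      · rintro (_ | i) -
        · simpa [w] using hx'
        · exact hx i
      · simp [w, Fintype.sum_option]
      · rintro (_ | i) - <;> apply subset_convexHull <;> simp [z]
  rw [hset, euclideanHausdorffMeasure_image_linearCombination hd p v
    (measurableSet_cornerSimplex ι 1), volume_cornerSimplex ι zero_le_one,
    ← ENNReal.ofReal_mul (Real.sqrt_nonneg _)]
  simp [div_eq_mul_inv, hd]


/-! ### Existence of a largest hyperplane section. -/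

/-- Among the sections of a compact set `C` by isometrically embedded copies of `E`, taken from a
compact family of embeddings with base point in `C`, one has maximal volume. -/
theorem exists_max_volume_preimage {E F : Type*} [NormedAddCommGroup E] [InnerProductSpace ℝ E]
    [FiniteDimensional ℝ E] [MeasurableSpace E] [BorelSpace E] [NormedAddCommGroup F]
    [InnerProductSpace ℝ F] {C : Set F} (hC : IsCompact C)
    {K : Set (F × (E →L[ℝ] F))} (hK : IsCompact K) (hne : K.Nonempty)
    (hKC : ∀ q ∈ K, q.1 ∈ C) (hiso : ∀ q ∈ K, ∀ x, ‖q.2 x‖ = ‖x‖) :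
    ∃ q ∈ K, ∀ q' ∈ K,
      volume {x | q'.1 + q'.2 x ∈ C} ≤ volume {x | q.1 + q.2 x ∈ C} := by
  set g : F × (E →L[ℝ] F) → ENNReal := fun q => volume {x | q.1 + q.2 x ∈ C} with hg
  obtain ⟨R, hR⟩ := hC.isBounded.exists_norm_le
  have hcl : ∀ q : F × (E →L[ℝ] F), IsClosed {x | q.1 + q.2 x ∈ C} := fun q =>
    hC.isClosed.preimage (by fun_prop)
  obtain ⟨s, -, hs, hsmem⟩ := exists_seq_tendsto_sSup (hne.image g) (OrderTop.bddAbove _)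
  choose q hqK hqs using hsmem
  obtain ⟨a, haK, ψ, hψ, hlim⟩ := hK.tendsto_subseq hqK
  refine ⟨a, haK, fun q' hq' => (le_sSup (Set.mem_image_of_mem g hq')).trans ?_⟩
  have hs' : Tendsto (fun n => g (q (ψ n))) atTop (𝓝 (sSup (g '' K))) := by
    simpa only [hqs, Function.comp_def] using hs.comp hψ.tendsto_atTop
  rw [← hs'.limsup_eq]
  have hind : ∀ b : F × (E →L[ℝ] F),
      g b = ∫⁻ x, {x | b.1 + b.2 x ∈ C}.indicator (fun _ => (1 : ENNReal)) x := fun b => by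
    rw [lintegral_indicator (hcl b).measurableSet]; simp [hg]
  change _ ≤ g a
  simp_rw [hind]
  -- Reverse Fatou gives upper semicontinuity along the maximizing subsequence. The ball dominates:
  -- base point and image point both lie in `C`, hence within `R` of the origin, and the embeddings
  -- preserve norms.
  refine (limsup_lintegral_le ((Metric.closedBall (0 : E) (2 * R)).indicator fun _ => 1)
    (fun n => measurable_const.indicator (hcl _).measurableSet) (fun n => ae_of_all _ fun x => ?_)
    ?_).trans (lintegral_mono fun x => ?_)
  · refine Set.indicator_le_indicator_of_subset ?_ (fun _ => zero_le) x
    intro x hx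
    have h1 := hR _ hx
    have h2 := hR _ (hKC _ (hqK (ψ n)))
    have h3 := norm_sub_le ((q (ψ n)).1 + (q (ψ n)).2 x) (q (ψ n)).1
    rw [add_sub_cancel_left, hiso _ (hqK _)] at h3
    rw [mem_closedBall_zero_iff]
    linarith
  · rw [lintegral_indicator Metric.isClosed_closedBall.measurableSet]
    simpa using (isCompact_closedBall (0 : E) (2 * R)).measure_lt_top.ne
  · by_cases hx : a.1 + a.2 x ∈ C
    · rw [Set.indicator_of_mem (show x ∈ {x | a.1 + a.2 x ∈ C} from hx)]
      refine limsup_le_of_le (by isBoundedDefault) (Eventually.of_forall fun n => ?_)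
      exact Set.indicator_le_self' (fun _ _ => zero_le) x
    -- Lying outside the closed set `C` is an open condition, so it holds eventually along the
    -- subsequence.
    · have hc : Tendsto (fun n => (q (ψ n)).1 + (q (ψ n)).2 x) atTop (𝓝 (a.1 + a.2 x)) := by
        have : Continuous fun b : F × (E →L[ℝ] F) => b.1 + b.2 x := by fun_prop
        exact (this.tendsto a).comp hlim
      have hev := hc.eventually (hC.isClosed.isOpen_compl.mem_nhds hx)
      refine limsup_le_of_le (by isBoundedDefault) (hev.mono fun n hn => ?_)
      rw [Set.indicator_of_notMem (show x ∉ {x | (q (ψ n)).1 + (q (ψ n)).2 x ∈ C} from hn)]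
      exact zero_le

theorem isCompact_setOf_isometry_into {E F : Type*} [NormedAddCommGroup E] [NormedSpace ℝ E]
    [FiniteDimensional ℝ E] [NormedAddCommGroup F] [NormedSpace ℝ F] [FiniteDimensional ℝ F]
    (D : Submodule ℝ F) :
    IsCompact {L : E →L[ℝ] F | ∀ x, ‖L x‖ = ‖x‖ ∧ L x ∈ D} := by
  have : ProperSpace (E →L[ℝ] F) := FiniteDimensional.proper ℝ _
  refine (isCompact_closedBall (0 : E →L[ℝ] F) 1).of_isClosed_subset ?_ fun L hL => ?_
  · simp only [Set.ofPred_forall, Set.ofPred_and]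
    refine isClosed_iInter fun x => IsClosed.inter ?_ ?_
    · exact isClosed_eq (by fun_prop) continuous_const
    · exact D.closed_of_finiteDimensional.preimage (by fun_prop)
  · rw [mem_closedBall_zero_iff]
    exact L.opNorm_le_bound zero_le_one fun x => by simp [(hL x).1]

/-- Replaces the volume in a varying plane by Lebesgue measure on one fixed space, where the
semicontinuity argument runs. -/
theorem euclideanHausdorffMeasure_inter_mk'_range {k N : ℕ}
    (C : Set (EuclideanSpace ℝ (Fin N))) (p : EuclideanSpace ℝ (Fin N))
    (L : EuclideanSpace ℝ (Fin k) →ₗᵢ[ℝ] EuclideanSpace ℝ (Fin N)) :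
    μHE[k] (C ∩ AffineSubspace.mk' p (LinearMap.range L.toLinearMap)) =
      volume {x | p + L x ∈ C} := by
  rw [← EuclideanSpace.euclideanHausdorffMeasure_eq_volume,
    ← ((isometry_add_left p).comp L.isometry).euclideanHausdorffMeasure_image]
  congr 1
  ext y
  simp only [Set.mem_inter_iff, SetLike.mem_coe, AffineSubspace.mem_mk', LinearMap.mem_range,
    Set.mem_image, Set.mem_ofPred_eq, Function.comp_apply, vsub_eq_sub]
  constructor
  · rintro ⟨hy, x, hx⟩
    have : p + L x = y := by
      rw [show L x = y - p from hx]; abel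
    exact ⟨x, this ▸ hy, this⟩
  · rintro ⟨x, hx, rfl⟩
    exact ⟨hx, x, by simp⟩

theorem exists_linearIsometry_range_eq {k N : ℕ} (D : Submodule ℝ (EuclideanSpace ℝ (Fin N)))
    (hD : Module.finrank ℝ D = k) :
    ∃ L : EuclideanSpace ℝ (Fin k) →ₗᵢ[ℝ] EuclideanSpace ℝ (Fin N),
      LinearMap.range L.toLinearMap = D := by
  subst hD
  refine ⟨D.subtypeₗᵢ.comp (stdOrthonormalBasis ℝ D).repr.symm.toLinearIsometry, ?_⟩
  ext y
  constructor
  · rintro ⟨x, rfl⟩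
    exact Subtype.coe_prop _
  · intro hy
    exact ⟨(stdOrthonormalBasis ℝ D).repr ⟨y, hy⟩, by simp⟩

/-- Every simplex has a hyperplane section of maximal volume. -/
theorem exists_largest_section {N n : ℕ} (hn : 1 ≤ n)
    (S : Affine.Simplex ℝ (EuclideanSpace ℝ (Fin N)) n) :
    ∃ H : AffineSubspace ℝ (EuclideanSpace ℝ (Fin N)), IsHyperplane S H ∧
      ∀ H' : AffineSubspace ℝ (EuclideanSpace ℝ (Fin N)), IsHyperplane S H' →
        μHE[n - 1] (S.closedInterior ∩ H') ≤ μHE[n - 1] (S.closedInterior ∩ H) := by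
  set A := affineSpan ℝ (Set.range S.points) with hA
  have hDrank : Module.finrank ℝ A.direction = n := by
    rw [hA, direction_affineSpan]
    exact S.independent.finrank_vectorSpan (by simp)
  obtain ⟨L₀, hL₀⟩ := exists_linearIsometry_range_eq A.direction hDrank
  have hSA : ∀ p ∈ S.closedInterior, p ∈ A := fun p hp =>
    S.closedInterior_subset_affineSpan hp
  -- Requiring the base point to lie in the simplex makes the parameter space compact; the
  -- hyperplanes lost miss the simplex and have empty section.
  let K : Set (EuclideanSpace ℝ (Fin N) ×
      (EuclideanSpace ℝ (Fin (n - 1)) →L[ℝ] EuclideanSpace ℝ (Fin N))) :=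
    S.closedInterior ×ˢ {L | ∀ x, ‖L x‖ = ‖x‖ ∧ L x ∈ A.direction}
  have hK : IsCompact K :=
    S.isCompact_closedInterior.prod (isCompact_setOf_isometry_into A.direction)
  have hKne : K.Nonempty := by
    obtain ⟨D', hD'⟩ : ∃ D' : Submodule ℝ (EuclideanSpace ℝ (Fin n)),
        Module.finrank ℝ D' = n - 1 := by
      have : Fact (Module.finrank ℝ (EuclideanSpace ℝ (Fin n)) = n - 1 + 1) :=
        ⟨by simp; omega⟩
      exact ⟨(ℝ ∙ EuclideanSpace.single (⟨0, hn⟩ : Fin n) (1 : ℝ))ᗮ,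
        Submodule.finrank_orthogonal_span_singleton (by simp)⟩
    obtain ⟨L₁, -⟩ := exists_linearIsometry_range_eq D' hD'
    refine ⟨(S.points 0, (L₀.comp L₁).toContinuousLinearMap), S.point_mem_closedInterior 0,
      fun x => ⟨by simp, ?_⟩⟩
    rw [← hL₀]
    exact ⟨L₁ x, rfl⟩
  obtain ⟨⟨p, L⟩, ⟨hp, hL⟩, hmax⟩ := exists_max_volume_preimage S.isCompact_closedInterior hK hKne
    (fun q hq => hq.1) (fun q hq x => (hq.2 x).1)
  let L' : EuclideanSpace ℝ (Fin (n - 1)) →ₗᵢ[ℝ] EuclideanSpace ℝ (Fin N) :=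
    ⟨L.toLinearMap, fun x => (hL x).1⟩
  refine ⟨AffineSubspace.mk' p (LinearMap.range L'.toLinearMap), ⟨?_, ⟨p, ?_⟩, ?_⟩, ?_⟩
  · rintro y ⟨x, hx⟩
    have h1 := A.vadd_mem_of_mem_direction (hL x).2 (hSA p hp)
    have h2 : L x = y - p := hx
    rw [h2] at h1
    simpa using h1
  · exact AffineSubspace.self_mem_mk' _ _
  · rw [AffineSubspace.direction_mk', LinearMap.finrank_range_of_inj L'.injective]
    simp; omega
  · rintro H' ⟨hH'A, -, hH'⟩
    rcases (S.closedInterior ∩ (H' : Set (EuclideanSpace ℝ (Fin N)))).eq_empty_or_nonempty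
      with h | ⟨p', hp', hp'H⟩
    · rw [h]; simp
    obtain ⟨M, hM⟩ := exists_linearIsometry_range_eq H'.direction
      (show _ = n - 1 by omega)
    have hmem : (p', M.toContinuousLinearMap) ∈ K := by
      refine ⟨hp', fun x => ⟨by simp, AffineSubspace.direction_le hH'A ?_⟩⟩
      rw [← hM]
      exact ⟨x, rfl⟩
    have hH'eq : H' = AffineSubspace.mk' p' (LinearMap.range M.toLinearMap) := by
      rw [hM, AffineSubspace.mk'_eq hp'H]
    rw [hH'eq, euclideanHausdorffMeasure_inter_mk'_range,
      euclideanHausdorffMeasure_inter_mk'_range]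
    exact hmax _ hmem

/-- The maximizer need not be identified: it is at least as large as the given section `H`. -/
theorem largestSectionNotFacet_of_facet_lt {N n : ℕ} (hn : 1 ≤ n)
    {S : Affine.Simplex ℝ (EuclideanSpace ℝ (Fin N)) n}
    {H : AffineSubspace ℝ (EuclideanSpace ℝ (Fin N))} (hH : IsHyperplane S H)
    (h : ∀ i, μHE[n - 1] (facet S i) < μHE[n - 1] (S.closedInterior ∩ H)) :
    LargestSectionNotFacet S := by
  obtain ⟨H', hH', hmax⟩ := exists_largest_section hn S
  exact ⟨H', hH', hmax, fun i => (h i).trans_le (hmax H hH)⟩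

/-! ### Transfer along isometric embeddings. -/

/-- The property only depends on the isometry class of the simplex, not on the ambient space. -/
theorem LargestSectionNotFacet.of_map {N M n : ℕ} (hn : 1 ≤ n)
    {S : Affine.Simplex ℝ (EuclideanSpace ℝ (Fin N)) n}
    {T : Affine.Simplex ℝ (EuclideanSpace ℝ (Fin M)) n}
    (ψ : EuclideanSpace ℝ (Fin M) →ᵃⁱ[ℝ] EuclideanSpace ℝ (Fin N))
    (hψ : S = T.map ψ.toAffineMap ψ.injective) (h : LargestSectionNotFacet S) :
    LargestSectionNotFacet T := by
  obtain ⟨H, ⟨hHS, hHne, hHrank⟩, -, hfacet⟩ := h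
  have hspan : affineSpan ℝ (Set.range S.points) =
      (affineSpan ℝ (Set.range T.points)).map ψ.toAffineMap := by
    rw [AffineSubspace.map_span, hψ, ← Set.range_comp]
    rfl
  -- `H` lies in the affine hull of `S`, hence in the range of `ψ`, so nothing is lost by pulling
  -- back.
  have hmap : (H.comap ψ.toAffineMap).map ψ.toAffineMap = H := by
    refine le_antisymm (AffineSubspace.map_comap_le _ _) fun y hy => ?_
    have := hHS hy
    rw [hspan] at this
    obtain ⟨x, -, rfl⟩ := this
    exact ⟨x, hy, rfl⟩
  have hsec : ψ '' (T.closedInterior ∩ H.comap ψ.toAffineMap) = S.closedInterior ∩ H := by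
    rw [hψ, Affine.Simplex.closedInterior_map]
    exact Set.image_inter_preimage _ _ _
  have hfac : ∀ i, ψ '' facet T i = facet S i := fun i => by
    have := AffineMap.image_convexHull ψ.toAffineMap (T.points '' {i}ᶜ)
    rw [facet, facet, hψ]
    refine this.trans ?_
    rw [Set.image_image]
    rfl
  refine largestSectionNotFacet_of_facet_lt hn (H := H.comap ψ.toAffineMap) ⟨?_, ?_, ?_⟩ ?_
  · intro x hx
    have := hHS hx
    rw [hspan] at this
    obtain ⟨x', hx', he⟩ := this
    exact ψ.injective he ▸ hx'
  · obtain ⟨y, hy⟩ := hHne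
    rw [← hmap] at hy
    obtain ⟨x, hx, -⟩ := hy
    exact ⟨x, hx⟩
  · rw [← hHrank]
    conv_rhs => rw [← hmap, AffineSubspace.map_direction]
    rw [(Submodule.equivMapOfInjective _ ψ.linearIsometry.injective _).finrank_eq]
    rfl
  · intro i
    rw [← ψ.isometry.euclideanHausdorffMeasure_image, ← ψ.isometry.euclideanHausdorffMeasure_image,
      hsec, hfac]
    exact hfacet i

/-- Every `n`-simplex is isometric to one in `ℝⁿ`. -/
theorem exists_map_eq {N n : ℕ} (S : Affine.Simplex ℝ (EuclideanSpace ℝ (Fin N)) n) :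
    ∃ (T : Affine.Simplex ℝ (EuclideanSpace ℝ (Fin n)) n)
      (ψ : EuclideanSpace ℝ (Fin n) →ᵃⁱ[ℝ] EuclideanSpace ℝ (Fin N)),
      S = T.map ψ.toAffineMap ψ.injective := by
  obtain ⟨L, hL⟩ := exists_linearIsometry_range_eq (vectorSpan ℝ (Set.range S.points))
    (S.independent.finrank_vectorSpan (n := n) (by simp))
  have hmem : ∀ i, ∃ x, L x = S.points i - S.points 0 := fun i => by
    have : S.points i -ᵥ S.points 0 ∈ LinearMap.range L.toLinearMap := by
      rw [hL]
      exact vsub_mem_vectorSpan ℝ (Set.mem_range_self i) (Set.mem_range_self 0)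
    exact this
  choose t ht using hmem
  let ψ : EuclideanSpace ℝ (Fin n) →ᵃⁱ[ℝ] EuclideanSpace ℝ (Fin N) :=
    (AffineIsometryEquiv.vaddConst ℝ (S.points 0)).toAffineIsometry.comp L.toAffineIsometry
  have hψ : ∀ i, ψ (t i) = S.points i := fun i => by
    simp [ψ, ht]
  refine ⟨⟨t, AffineIndependent.of_comp ψ.toAffineMap ?_⟩, ψ, ?_⟩
  · convert! S.independent using 1
    ext1 i
    exact hψ i
  · ext1 i
    exact (hψ i).symm


/-! ### The compression map and the compressed simplex. -/

theorem normal_apply (n : ℕ) (i : Fin (n + 1)) :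
    normal n i = if 2 * (i : ℕ) < n + 1 then 1 else -1 := rfl

theorem normal_mul_self (n : ℕ) (i : Fin (n + 1)) : normal n i * normal n i = 1 := by
  rw [normal_apply]; split_ifs <;> norm_num

theorem inner_normal (n : ℕ) (x : EuclideanSpace ℝ (Fin (n + 1))) :
    inner ℝ (normal n) x = ∑ i, normal n i * x i := by
  simp [PiLp.inner_apply, mul_comm]

/-- The splitting of the `2k + 2` coordinates into the two halves on which `normal` is constant. -/
def halves (k : ℕ) : Fin (k + 1) ⊕ Fin (k + 1) ≃ Fin (2 * k + 1 + 1) :=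
  finSumFinEquiv.trans (finCongr (by omega))

@[simp]
theorem normal_halves_inl (k : ℕ) (i : Fin (k + 1)) :
    normal (2 * k + 1) (halves k (Sum.inl i)) = 1 := by
  have := i.2
  rw [normal_apply, if_pos]
  simp [halves]; omega

@[simp]
theorem normal_halves_inr (k : ℕ) (i : Fin (k + 1)) :
    normal (2 * k + 1) (halves k (Sum.inr i)) = -1 := by
  rw [normal_apply, if_neg]
  simp [halves]; omega

theorem sum_normal (k : ℕ) : ∑ i, normal (2 * k + 1) i = 0 := by
  rw [← (halves k).sum_comp]
  simp

theorem inner_normal_self (n : ℕ) : inner ℝ (normal n) (normal n) = (n : ℝ) + 1 := by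
  rw [inner_normal]; simp [normal_mul_self]

/-- `compress` as a linear map. -/
def compressLinear (n : ℕ) (δ : ℝ) :
    EuclideanSpace ℝ (Fin (n + 1)) →ₗ[ℝ] EuclideanSpace ℝ (Fin (n + 1)) where
  toFun := compress n δ
  map_add' x y := by
    simp only [compress, inner_add_right, mul_add, add_smul]; abel
  map_smul' c x := by
    simp only [compress, inner_smul_right, RingHom.id_apply, smul_add, smul_smul]
    congr 2; ring

@[simp]
theorem compressLinear_apply (n : ℕ) (δ : ℝ) (x) : compressLinear n δ x = compress n δ x := rfl

theorem inner_normal_compress (n : ℕ) (δ : ℝ) (x) :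
    inner ℝ (normal n) (compress n δ x) = (1 + (n + 1) * δ) * inner ℝ (normal n) x := by
  rw [compress, inner_add_right, inner_smul_right, inner_normal_self]; ring

theorem compress_of_inner_eq_zero {n : ℕ} (δ : ℝ) {x} (hx : inner ℝ (normal n) x = 0) :
    compress n δ x = x := by
  simp [compress, hx]

/-- Every Gram matrix changes by rank one only. The coefficient is `((1 + (n+1)δ)² - 1)/(n+1)`. -/
theorem inner_compress_compress (n : ℕ) (δ : ℝ) (x y) :
    inner ℝ (compress n δ x) (compress n δ y) =
      inner ℝ x y + (2 * δ + (n + 1) * δ ^ 2) *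
        (inner ℝ (normal n) x * inner ℝ (normal n) y) := by
  simp only [compress, inner_add_left, inner_add_right, inner_smul_left, inner_smul_right,
    inner_normal_self, real_inner_comm (normal n) x]
  simp only [RCLike.conj_to_real]
  ring

/-- A kernel vector is orthogonal to `u`, because `⟨u, ·⟩` is scaled by a nonzero factor; there the
map is the identity. -/
theorem compressLinear_injective {n : ℕ} {δ : ℝ} (h : 1 + ((n : ℝ) + 1) * δ ≠ 0) :
    Function.Injective (compressLinear n δ) := by
  rw [← LinearMap.ker_eq_bot, LinearMap.ker_eq_bot']
  intro x hx
  have h1 := inner_normal_compress n δ x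
  rw [← compressLinear_apply, hx, inner_zero_right] at h1
  have h2 := (mul_eq_zero.1 h1.symm).resolve_left h
  rwa [compressLinear_apply, compress_of_inner_eq_zero δ h2] at hx

theorem affineIndependent_compress {n : ℕ} {δ : ℝ} (h : 1 + ((n : ℝ) + 1) * δ ≠ 0) :
    AffineIndependent ℝ fun j : Fin (n + 1) => compress n δ (EuclideanSpace.single j 1) := by
  have h1 : LinearIndependent ℝ fun j : Fin (n + 1) => EuclideanSpace.single j (1 : ℝ) := by
    convert! (EuclideanSpace.basisFun (Fin (n + 1)) ℝ).orthonormal.linearIndependent using 1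
    ext1 j
    simp
  exact (h1.map' (compressLinear n δ)
    (LinearMap.ker_eq_bot.2 (compressLinear_injective h))).affineIndependent

/-- The compressed regular simplex; the junk value for the `δ` where it degenerates is the regular
simplex. -/
def compressedSimplex (n : ℕ) (δ : ℝ) : Affine.Simplex ℝ (EuclideanSpace ℝ (Fin (n + 1))) n :=
  if h : 1 + ((n : ℝ) + 1) * δ ≠ 0 then ⟨_, affineIndependent_compress h⟩
  else ⟨_, affineIndependent_compress (δ := 0) (by simp)⟩

theorem compressedSimplex_points {n : ℕ} {δ : ℝ} (h : 1 + ((n : ℝ) + 1) * δ ≠ 0)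
    (j : Fin (n + 1)) :
    (compressedSimplex n δ).points j = compress n δ (EuclideanSpace.single j 1) := by
  rw [compressedSimplex, dif_pos h]

theorem inner_normal_single (n : ℕ) (j : Fin (n + 1)) :
    inner ℝ (normal n) (EuclideanSpace.single j 1) = normal n j := by
  rw [inner_normal]; simp

theorem inner_single_single {ι : Type*} [Fintype ι] [DecidableEq ι] (i j : ι) :
    inner ℝ (EuclideanSpace.single i (1 : ℝ)) (EuclideanSpace.single j (1 : ℝ)) =
      if i = j then 1 else 0 := by
  simp [EuclideanSpace.inner_single_left]

/-! ### Volume of the facets. -/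

/-- The determinant of a perturbation of the identity by two symmetric rank one matrices. -/
theorem det_one_add_outer {ι : Type*} [Fintype ι] [DecidableEq ι] (b a : ι → ℝ) (c : ℝ) :
    (Matrix.of fun i j => (if i = j then 1 else 0) + b i * b j + c * (a i * a j) :
      Matrix ι ι ℝ).det =
      (1 + ∑ i, b i * b i) * (1 + c * ∑ i, a i * a i) - c * (∑ i, a i * b i) ^ 2 := by
  -- Factoring the perturbation through `Fin 2` lets Sylvester's identity reduce the determinant to
  -- a 2×2 one.
  have h : (Matrix.of fun i j => (if i = j then 1 else 0) + b i * b j + c * (a i * a j) :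
      Matrix ι ι ℝ) = 1 + (Matrix.of fun i => ![b i, c * a i] : Matrix ι (Fin 2) ℝ) *
        (Matrix.of ![b, a] : Matrix (Fin 2) ι ℝ) := by
    ext i j
    simp [Matrix.mul_apply, Fin.sum_univ_two, Matrix.one_apply]
    ring
  rw [h, Matrix.det_one_add_mul_comm, Matrix.det_fin_two]
  simp only [Matrix.add_apply, Matrix.mul_apply, Matrix.of_apply, Matrix.cons_val_zero,
    Matrix.cons_val_one, Matrix.one_apply_eq, Matrix.cons_val_fin_one, Fin.isValue, ne_eq,
    zero_ne_one, one_ne_zero, not_false_eq_true, Matrix.one_apply_ne, zero_add]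
  have e1 : ∀ x, a x * (c * a x) = c * (a x * a x) := fun x => by ring
  have e2 : ∀ x, b x * (c * a x) = c * (a x * b x) := fun x => by ring
  simp only [e1, e2, ← Finset.mul_sum]
  ring

/-- The Gram determinant of the edges at a vertex of a facet of the compressed simplex, whose square
root is `(2 * k)!` times the volume of the facet. -/
def facetGram (k : ℕ) (δ : ℝ) : ℝ :=
  (2 * k + 1) + (2 * δ + (2 * k + 2) * δ ^ 2) * ((2 * k + 2) * (2 * k))

theorem sum_subtype_ne_ne {α : Type*} [Fintype α] [DecidableEq α] {i j : α} {f : α → ℝ}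
    (hi : f i = 0) (hj : f j = 0) : ∑ l : {l // l ≠ i ∧ l ≠ j}, f l = ∑ l, f l := by
  rw [← Finset.sum_subtype (Finset.univ.filter fun l => l ≠ i ∧ l ≠ j) (by simp),
    Finset.sum_filter_of_ne]
  rintro x - hx
  exact ⟨by rintro rfl; exact hx hi, by rintro rfl; exact hx hj⟩

/-- Supplies a base vertex `j` of the facet in the same half as the omitted vertex `i`. Then `u l -
u j` vanishes at both, and sums over the facet's edges become sums over all vertices. -/
theorem exists_ne_normal_eq {k : ℕ} (hk : 1 ≤ k) (i : Fin (2 * k + 1 + 1)) :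
    ∃ j, j ≠ i ∧ normal (2 * k + 1) j = normal (2 * k + 1) i := by
  obtain ⟨m, rfl⟩ : ∃ m, k = m + 1 := ⟨k - 1, by omega⟩
  obtain ⟨a, rfl⟩ := (halves (m + 1)).surjective i
  rcases a with a | a
  · obtain ⟨b, hb⟩ := exists_ne a
    exact ⟨halves _ (Sum.inl b), by simpa using hb, by simp⟩
  · obtain ⟨b, hb⟩ := exists_ne a
    exact ⟨halves _ (Sum.inr b), by simpa using hb, by simp⟩

theorem card_subtype_ne_ne {k : ℕ} {i j : Fin (2 * k + 1 + 1)} (hij : j ≠ i) :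
    Fintype.card {l // l ≠ i ∧ l ≠ j} = 2 * k := by
  rw [Fintype.card_subtype]
  have : (Finset.univ.filter fun l : Fin (2 * k + 1 + 1) => l ≠ i ∧ l ≠ j) = {i, j}ᶜ := by
    ext; simp
  rw [this, Finset.card_compl, Finset.card_pair hij.symm]
  simp

theorem facet_volume {k : ℕ} (hk : 1 ≤ k) {δ : ℝ} (h : 1 + (((2 * k + 1 : ℕ) : ℝ) + 1) * δ ≠ 0)
    (i : Fin (2 * k + 1 + 1)) :
    μHE[2 * k] (facet (compressedSimplex (2 * k + 1) δ) i) =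
      ENNReal.ofReal (√(facetGram k δ) / ((2 * k)! : ℕ)) := by
  obtain ⟨j, hji, hj⟩ := exists_ne_normal_eq hk i
  let P := (compressedSimplex (2 * k + 1) δ).points
  let v : {l // l ≠ i ∧ l ≠ j} → EuclideanSpace ℝ (Fin (2 * k + 1 + 1)) := fun l => P l - P j
  have hset : facet (compressedSimplex (2 * k + 1) δ) i =
      convexHull ℝ (insert (P j) (Set.range fun l => P j + v l)) := by
    rw [facet]
    congr 1
    ext x
    simp only [Set.mem_image, Set.mem_compl_iff, Set.mem_singleton_iff, Set.mem_insert_iff,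
      Set.mem_range, v, add_sub_cancel]
    constructor
    · rintro ⟨l, hl, rfl⟩
      by_cases hlj : l = j
      · exact Or.inl (hlj ▸ rfl)
      · exact Or.inr ⟨⟨l, hl, hlj⟩, rfl⟩
    · rintro (rfl | ⟨l, rfl⟩)
      · exact ⟨j, hji, rfl⟩
      · exact ⟨l, l.2.1, rfl⟩
  have hcard := card_subtype_ne_ne hji
  rw [hset, euclideanHausdorffMeasure_convexHull hcard]
  congr 3
  set u := normal (2 * k + 1) with hu
  set c : ℝ := 2 * δ + (2 * k + 2) * δ ^ 2 with hc
  have hgram : Matrix.gram ℝ v = Matrix.of fun a b : {l // l ≠ i ∧ l ≠ j} =>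
      (if a = b then 1 else 0) + 1 * 1 + c * ((u a - u j) * (u b - u j)) := by
    ext a b
    have hv : ∀ l : {l // l ≠ i ∧ l ≠ j}, v l =
        compress (2 * k + 1) δ (EuclideanSpace.single l.1 1 - EuclideanSpace.single j 1) := by
      intro l
      simp only [v, P, compressedSimplex_points h]
      exact ((compressLinear (2 * k + 1) δ).map_sub _ _).symm
    rw [Matrix.gram_apply, hv, hv, inner_compress_compress]
    have ha := a.2.2
    have hb := b.2.2.symm
    have hw : ∀ l, inner ℝ u (EuclideanSpace.single l 1) = u l := inner_normal_single _
    simp only [inner_sub_right, inner_sub_left, inner_single_single, ← hu, hw]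
    have hab : (if (a : Fin (2 * k + 1 + 1)) = b then (1 : ℝ) else 0) = if a = b then 1 else 0 := by
      simp [Subtype.ext_iff]
    simp only [ha, hb, hc, ← hab, if_false, if_true, Matrix.of_apply]
    push_cast
    ring
  rw [hgram, det_one_add_outer (fun _ => 1) (fun l : {l // l ≠ i ∧ l ≠ j} => u l - u j)]
  -- Each `u l - u j` is `0` in the half of `j` and `-2 * u j` at the `k + 1` vertices of the other
  -- half.
  have hS1 : ∑ l : {l // l ≠ i ∧ l ≠ j}, (u l - u j) * 1 = -(2 * k + 2) * u j := by
    rw [sum_subtype_ne_ne (f := fun l => (u l - u j) * 1) (by simp [hj]) (by simp)]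
    simp [hu, sum_normal]
    ring
  have hS2 : ∑ l : {l // l ≠ i ∧ l ≠ j}, (u l - u j) * (u l - u j) = 2 * (2 * k + 2) := by
    rw [sum_subtype_ne_ne (f := fun l => (u l - u j) * (u l - u j)) (by simp [hj]) (by simp)]
    have : ∀ l, (u l - u j) * (u l - u j) = 2 - 2 * u j * u l := fun l => by
      linear_combination normal_mul_self _ l + normal_mul_self _ j
    simp_rw [this, Finset.sum_sub_distrib, ← Finset.mul_sum, hu, sum_normal]
    simp
    ring
  rw [hS1, hS2]
  have huj : u j ^ 2 = 1 := by rw [pow_two]; exact normal_mul_self _ j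
  simp only [mul_one, Finset.sum_const, Finset.card_univ, hcard, facetGram, mul_pow, huj,
    nsmul_eq_mul]
  push_cast
  ring


/-! ### Volume of the central section. -/

theorem volume_setOf_sum_cornerSimplex (α β : Type*) [Fintype α] [Fintype β] {s t : ℝ}
    (hs : 0 ≤ s) (ht : 0 ≤ t) :
    volume {w : α ⊕ β → ℝ | w ∘ Sum.inl ∈ cornerSimplex α s ∧ w ∘ Sum.inr ∈ cornerSimplex β t} =
      ENNReal.ofReal (s ^ Fintype.card α / ((Fintype.card α)! : ℕ) *
        (t ^ Fintype.card β / ((Fintype.card β)! : ℕ))) := by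
  rw [ENNReal.ofReal_mul (by positivity), ← volume_cornerSimplex α hs, ← volume_cornerSimplex β ht,
    ← Measure.prod_prod, ← Measure.volume_eq_prod,
    ← (volume_measurePreserving_sumPiEquivProdPi fun _ : α ⊕ β => ℝ).measure_preimage_equiv]
  rfl

theorem measurableSet_setOf_sum_cornerSimplex (α β : Type*) [Fintype α] [Fintype β] (s t : ℝ) :
    MeasurableSet
      {w : α ⊕ β → ℝ | w ∘ Sum.inl ∈ cornerSimplex α s ∧ w ∘ Sum.inr ∈ cornerSimplex β t} :=
  ((measurableSet_cornerSimplex α s).preimage (by fun_prop)).inter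
    ((measurableSet_cornerSimplex β t).preimage (by fun_prop))

theorem affineCombination_compressedSimplex {n : ℕ} {δ : ℝ} (h : 1 + ((n : ℝ) + 1) * δ ≠ 0)
    {w : Fin (n + 1) → ℝ} (hw : ∑ i, w i = 1) :
    Finset.univ.affineCombination ℝ (compressedSimplex n δ).points w =
      compress n δ (WithLp.toLp 2 w) := by
  rw [Finset.univ.affineCombination_eq_linear_combination _ _ hw]
  have h1 : WithLp.toLp 2 w = ∑ i, w i • EuclideanSpace.single i (1 : ℝ) := by
    ext j
    simp [Pi.single_apply]
  rw [h1, ← compressLinear_apply, map_sum]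
  simp [compressedSimplex_points h]

theorem mem_closedInterior_compressedSimplex {n : ℕ} {δ : ℝ} (h : 1 + ((n : ℝ) + 1) * δ ≠ 0)
    {x : EuclideanSpace ℝ (Fin (n + 1))} :
    x ∈ (compressedSimplex n δ).closedInterior ↔
      ∃ y : EuclideanSpace ℝ (Fin (n + 1)),
        (∀ i, 0 ≤ y i) ∧ ∑ i, y i = 1 ∧ compress n δ y = x := by
  constructor
  · rintro ⟨w, hw, hi, rfl⟩
    exact ⟨WithLp.toLp 2 w, fun i => (hi i).1, hw, (affineCombination_compressedSimplex h hw).symm⟩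
  · rintro ⟨y, hy, hsum, rfl⟩
    refine ⟨y.ofLp, hsum, fun i => ⟨hy i, ?_⟩, affineCombination_compressedSimplex h hsum⟩
    rw [← hsum]
    exact Finset.single_le_sum (fun j _ => hy j) (Finset.mem_univ i)

/-- The right-hand side is free of `δ`: compression preserves and reflects `⟨u, y⟩ = 0` and fixes
such `y`. -/
theorem mem_centralSection_compressedSimplex {n : ℕ} {δ : ℝ} (h : 1 + ((n : ℝ) + 1) * δ ≠ 0)
    {x : EuclideanSpace ℝ (Fin (n + 1))} :
    x ∈ centralSection (compressedSimplex n δ) ↔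
      (∀ i, 0 ≤ x i) ∧ ∑ i, x i = 1 ∧ ∑ i, normal n i * x i = 0 := by
  rw [← inner_normal, centralSection, Set.mem_inter_iff, mem_closedInterior_compressedSimplex h,
    Set.mem_ofPred_eq]
  constructor
  · rintro ⟨⟨y, hy, hsum, rfl⟩, h0⟩
    have h1 := h0
    rw [inner_normal_compress] at h1
    have h2 := (mul_eq_zero.1 h1).resolve_left h
    rw [compress_of_inner_eq_zero δ h2]
    exact ⟨hy, hsum, h2⟩
  · rintro ⟨hx, hsum, h0⟩
    exact ⟨⟨x, hx, hsum, compress_of_inner_eq_zero δ h0⟩, h0⟩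

theorem mem_affineSpan_compressedSimplex {n : ℕ} {δ : ℝ} (h : 1 + ((n : ℝ) + 1) * δ ≠ 0)
    {x : EuclideanSpace ℝ (Fin (n + 1))} (hsum : ∑ i, x i = 1)
    (h0 : ∑ i, normal n i * x i = 0) :
    x ∈ affineSpan ℝ (Set.range (compressedSimplex n δ).points) := by
  rw [← inner_normal] at h0
  have h1 := affineCombination_compressedSimplex h hsum
  rw [WithLp.toLp_ofLp, compress_of_inner_eq_zero δ h0] at h1
  rw [← h1]
  exact affineCombination_mem_affineSpan hsum _

/-- The midpoint of two vertices of the regular simplex, one from each half. -/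
def centralPoint (k : ℕ) : EuclideanSpace ℝ (Fin (2 * k + 1 + 1)) :=
  (1 / 2 : ℝ) • (EuclideanSpace.single (halves k (Sum.inl 0)) 1 +
    EuclideanSpace.single (halves k (Sum.inr 0)) 1)

/-- A basis of the direction space of the central section. -/
def centralEdge (k : ℕ) : Fin k ⊕ Fin k → EuclideanSpace ℝ (Fin (2 * k + 1 + 1)) :=
  Sum.elim
    (fun a => EuclideanSpace.single (halves k (Sum.inl a.succ)) 1 -
      EuclideanSpace.single (halves k (Sum.inl 0)) 1)
    (fun b => EuclideanSpace.single (halves k (Sum.inr b.succ)) 1 -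
      EuclideanSpace.single (halves k (Sum.inr 0)) 1)

/-- Edges from different halves are orthogonal, and each half contributes a block `I + 11ᵀ` of
determinant `k + 1`. -/
theorem det_gram_centralEdge (k : ℕ) :
    (Matrix.gram ℝ (centralEdge k)).det = ((k : ℝ) + 1) ^ 2 := by
  have h : Matrix.gram ℝ (centralEdge k) = Matrix.of fun i j : Fin k ⊕ Fin k =>
      (if i = j then 1 else 0) +
        Sum.elim (fun _ : Fin k => (1 : ℝ)) (fun _ : Fin k => 0) i *
          Sum.elim (fun _ : Fin k => (1 : ℝ)) (fun _ : Fin k => 0) j +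
        1 * (Sum.elim (fun _ : Fin k => (0 : ℝ)) (fun _ : Fin k => 1) i *
          Sum.elim (fun _ : Fin k => (0 : ℝ)) (fun _ : Fin k => 1) j) := by
    ext i j
    rcases i with i | i <;> rcases j with j | j <;>
      simp [Matrix.gram_apply, centralEdge, inner_sub_left, inner_sub_right, inner_single_single,
        (halves k).injective.eq_iff, Fin.succ_ne_zero, (Fin.succ_ne_zero _).symm]
  rw [h, det_one_add_outer]
  simp
  ring

theorem centralPoint_add_sum_apply_inl_zero (k : ℕ) (w : Fin k ⊕ Fin k → ℝ) :
    (centralPoint k + ∑ i, w i • centralEdge k i) (halves k (Sum.inl 0)) =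
      1 / 2 - ∑ a, w (Sum.inl a) := by
  simp [centralPoint, centralEdge, Fintype.sum_sum_type,
    (Fin.succ_ne_zero _).symm, ← sub_eq_add_neg]

theorem centralPoint_add_sum_apply_inr_zero (k : ℕ) (w : Fin k ⊕ Fin k → ℝ) :
    (centralPoint k + ∑ i, w i • centralEdge k i) (halves k (Sum.inr 0)) =
      1 / 2 - ∑ a, w (Sum.inr a) := by
  simp [centralPoint, centralEdge, Fintype.sum_sum_type,
    (Fin.succ_ne_zero _).symm, ← sub_eq_add_neg]

theorem centralPoint_add_sum_apply_inl_succ (k : ℕ) (w : Fin k ⊕ Fin k → ℝ) (a : Fin k) :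
    (centralPoint k + ∑ i, w i • centralEdge k i) (halves k (Sum.inl a.succ)) =
      w (Sum.inl a) := by
  simp [centralPoint, centralEdge, Pi.single_apply, Fintype.sum_sum_type, Fin.succ_ne_zero]

theorem centralPoint_add_sum_apply_inr_succ (k : ℕ) (w : Fin k ⊕ Fin k → ℝ) (a : Fin k) :
    (centralPoint k + ∑ i, w i • centralEdge k i) (halves k (Sum.inr a.succ)) =
      w (Sum.inr a) := by
  simp [centralPoint, centralEdge, Pi.single_apply, Fintype.sum_sum_type, Fin.succ_ne_zero]

theorem sum_centralPoint_add_sum (k : ℕ) (w : Fin k ⊕ Fin k → ℝ) :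
    ∑ i, (centralPoint k + ∑ j, w j • centralEdge k j) i = 1 := by
  rw [← (halves k).sum_comp, Fintype.sum_sum_type, Fin.sum_univ_succ, Fin.sum_univ_succ]
  simp only [centralPoint_add_sum_apply_inl_zero, centralPoint_add_sum_apply_inr_zero,
    centralPoint_add_sum_apply_inl_succ, centralPoint_add_sum_apply_inr_succ]
  ring

theorem sum_normal_mul_centralPoint_add_sum (k : ℕ) (w : Fin k ⊕ Fin k → ℝ) :
    ∑ i, normal (2 * k + 1) i * (centralPoint k + ∑ j, w j • centralEdge k j) i = 0 := by
  rw [← (halves k).sum_comp, Fintype.sum_sum_type, Fin.sum_univ_succ, Fin.sum_univ_succ]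
  simp only [centralPoint_add_sum_apply_inl_zero, centralPoint_add_sum_apply_inr_zero,
    centralPoint_add_sum_apply_inl_succ, centralPoint_add_sum_apply_inr_succ, normal_halves_inl,
    normal_halves_inr, ← Finset.mul_sum]
  ring

/-- Total sum `1` and `⟨u, x⟩ = 0` force sum `1/2` on each half; eliminating the coordinate `0` of
each half leaves two corner simplices with legs `1/2`. -/
theorem centralSection_compressedSimplex {k : ℕ} {δ : ℝ}
    (h : 1 + (((2 * k + 1 : ℕ) : ℝ) + 1) * δ ≠ 0) :
    centralSection (compressedSimplex (2 * k + 1) δ) =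
      (fun w : Fin k ⊕ Fin k → ℝ => centralPoint k + ∑ i, w i • centralEdge k i) ''
        {w | w ∘ Sum.inl ∈ cornerSimplex (Fin k) (1 / 2) ∧
          w ∘ Sum.inr ∈ cornerSimplex (Fin k) (1 / 2)} := by
  ext x
  rw [mem_centralSection_compressedSimplex h]
  constructor
  · rintro ⟨hx, hsum, h0⟩
    rw [← (halves k).sum_comp, Fintype.sum_sum_type, Fin.sum_univ_succ, Fin.sum_univ_succ]
      at hsum h0
    simp only [normal_halves_inl, normal_halves_inr, neg_mul, one_mul,
      Finset.sum_neg_distrib] at h0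
    have hl := hx (halves k (Sum.inl 0))
    have hr := hx (halves k (Sum.inr 0))
    refine ⟨Sum.elim (fun a => x (halves k (Sum.inl a.succ)))
      (fun a => x (halves k (Sum.inr a.succ))), ⟨⟨fun a => hx _, ?_⟩, ⟨fun a => hx _, ?_⟩⟩, ?_⟩
    · simp only [Function.comp_apply, Sum.elim_inl]; linarith
    · simp only [Function.comp_apply, Sum.elim_inr]; linarith
    · ext i
      obtain ⟨i, rfl⟩ := (halves k).surjective i
      rcases i with i | i <;> refine Fin.cases ?_ (fun a => ?_) i
      · refine (centralPoint_add_sum_apply_inl_zero k _).trans ?_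
        simp only [Sum.elim_inl]; linarith
      · exact centralPoint_add_sum_apply_inl_succ k _ a
      · refine (centralPoint_add_sum_apply_inr_zero k _).trans ?_
        simp only [Sum.elim_inr]; linarith
      · exact centralPoint_add_sum_apply_inr_succ k _ a
  · rintro ⟨w, ⟨⟨hl, hl'⟩, ⟨hr, hr'⟩⟩, rfl⟩
    refine ⟨fun i => ?_, sum_centralPoint_add_sum k w, sum_normal_mul_centralPoint_add_sum k w⟩
    obtain ⟨i, rfl⟩ := (halves k).surjective i
    rcases i with i | i <;> refine Fin.cases ?_ (fun a => ?_) i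
    · rw [centralPoint_add_sum_apply_inl_zero]; exact sub_nonneg.2 hl'
    · rw [centralPoint_add_sum_apply_inl_succ]; exact hl a
    · rw [centralPoint_add_sum_apply_inr_zero]; exact sub_nonneg.2 hr'
    · rw [centralPoint_add_sum_apply_inr_succ]; exact hr a

theorem centralSection_volume {k : ℕ} {δ : ℝ} (h : 1 + (((2 * k + 1 : ℕ) : ℝ) + 1) * δ ≠ 0) :
    μHE[2 * k] (centralSection (compressedSimplex (2 * k + 1) δ)) =
      ENNReal.ofReal (((k : ℝ) + 1) * ((1 / 2) ^ k / (k ! : ℕ)) ^ 2) := by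
  rw [centralSection_compressedSimplex h, euclideanHausdorffMeasure_image_linearCombination
    (by simp; ring) _ _ (measurableSet_setOf_sum_cornerSimplex _ _ _ _),
    volume_setOf_sum_cornerSimplex _ _ (by norm_num) (by norm_num), det_gram_centralEdge,
    Real.sqrt_sq (by positivity), ← ENNReal.ofReal_mul (by positivity), Fintype.card_fin, pow_two]

/-- The central section spans a hyperplane of the affine hull of the compressed simplex. -/
theorem exists_isHyperplane_centralSection_subset {k : ℕ} {δ : ℝ}
    (h : 1 + (((2 * k + 1 : ℕ) : ℝ) + 1) * δ ≠ 0) :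
    ∃ H : AffineSubspace ℝ (EuclideanSpace ℝ (Fin (2 * k + 1 + 1))),
      IsHyperplane (compressedSimplex (2 * k + 1) δ) H ∧
      centralSection (compressedSimplex (2 * k + 1) δ) ⊆
        (compressedSimplex (2 * k + 1) δ).closedInterior ∩ H := by
  have hmk : ∀ w : Fin k ⊕ Fin k → ℝ, centralPoint k + ∑ i, w i • centralEdge k i ∈
      AffineSubspace.mk' (centralPoint k) (Submodule.span ℝ (Set.range (centralEdge k))) := by
    intro w
    rw [AffineSubspace.mem_mk', vsub_eq_sub, add_sub_cancel_left]
    exact Submodule.sum_mem _ fun i _ =>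
      Submodule.smul_mem _ _ (Submodule.subset_span (Set.mem_range_self i))
  refine ⟨AffineSubspace.mk' (centralPoint k) (Submodule.span ℝ (Set.range (centralEdge k))),
    ⟨?_, ⟨_, AffineSubspace.self_mem_mk' _ _⟩, ?_⟩, fun x hx => ⟨hx.1, ?_⟩⟩
  · intro x hx
    rw [AffineSubspace.mem_mk', Submodule.mem_span_range_iff_exists_fun] at hx
    obtain ⟨w, hw⟩ := hx
    have hx' : x = centralPoint k + ∑ i, w i • centralEdge k i := by
      rw [hw, vsub_eq_sub]; abel
    rw [hx']
    exact mem_affineSpan_compressedSimplex h (sum_centralPoint_add_sum k w)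
      (sum_normal_mul_centralPoint_add_sum k w)
  · have hli : LinearIndependent ℝ (centralEdge k) := by
      apply Matrix.linearIndependent_of_det_gram_ne_zero
      rw [det_gram_centralEdge]
      positivity
    rw [AffineSubspace.direction_mk', finrank_span_eq_card hli]
    simp; ring
  · rw [centralSection_compressedSimplex h] at hx
    obtain ⟨w, -, rfl⟩ := hx
    exact hmk w


/-! ### The limit ratio and the conclusion. -/

theorem one_add_mul_pos {n : ℕ} {δ : ℝ} (h : -1 / ((n : ℝ) + 1) < δ) :
    0 < 1 + ((n : ℝ) + 1) * δ := by
  rw [div_lt_iff₀ (by positivity)] at h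
  linarith

/-- At the endpoint `2δ + (2k+2)δ² = -1/(2k+2)`, so the value is `(2k+1) - 2k`. It is nonzero: in
the limit the map projects along `u`, which is not a direction of any regular facet. -/
theorem tendsto_facetGram (k : ℕ) :
    Tendsto (facetGram k) (𝓝[>] (-1 / (((2 * k + 1 : ℕ) : ℝ) + 1))) (𝓝 1) := by
  have hc : Continuous (facetGram k) := by unfold facetGram; fun_prop
  have hv : facetGram k (-1 / (((2 * k + 1 : ℕ) : ℝ) + 1)) = 1 := by
    have : (2 * (k : ℝ) + 1 + 1) ≠ 0 := by positivity
    rw [facetGram]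
    push_cast
    field_simp
    ring
  have := hc.tendsto (-1 / (((2 * k + 1 : ℕ) : ℝ) + 1))
  rw [hv] at this
  exact this.mono_left nhdsWithin_le_nhds

/-- The limit ratio between the volumes of the central section and of a facet. -/
def limitRatio (k : ℕ) : ℝ :=
  ((k : ℝ) + 1) * ((1 / 2) ^ k / (k ! : ℕ)) ^ 2 * ((2 * k)! : ℕ)

theorem limitRatio_eq (k : ℕ) :
    limitRatio k =
      (((2 * k + 1 : ℕ) : ℝ) + 1) * ((2 * k)! : ℕ) / (2 * (((2 * k)‼ : ℕ) : ℝ) ^ 2) := by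
  rw [limitRatio, Nat.doubleFactorial_two_mul]
  push_cast
  rw [one_div, inv_pow]
  field_simp
  ring

theorem limitRatio_eq_centralBinom (k : ℕ) :
    limitRatio k = ((k : ℝ) + 1) * k.centralBinom / 4 ^ k := by
  have h := Nat.choose_mul_factorial_mul_factorial (show k ≤ 2 * k by omega)
  rw [show 2 * k - k = k by omega, ← Nat.centralBinom_eq_two_mul_choose] at h
  have h' : ((2 * k)! : ℝ) = k.centralBinom * k ! * k ! := by exact_mod_cast h.symm
  rw [limitRatio, h', one_div, inv_pow, show (4 : ℝ) = 2 ^ 2 by norm_num, ← pow_mul]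
  field_simp
  ring

theorem one_lt_limitRatio {k : ℕ} (hk : 2 ≤ k) : 1 < limitRatio k := by
  rw [limitRatio_eq_centralBinom, one_lt_div (by positivity)]
  have : 4 ^ k < (k + 1) * k.centralBinom := by
    induction k, hk using Nat.le_induction with
    -- Here `16 < 18`. For `k = 1` both sides are `4`, so strictness starts at `n = 5`.
    | base => decide
    | succ k hk ih =>
      have h := Nat.succ_mul_centralBinom_succ k
      rw [pow_succ]
      nlinarith
  exact_mod_cast this

theorem tendsto_volume_ratio {k : ℕ} (hk : 1 ≤ k) (i : Fin (2 * k + 1 + 1)) :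
    Tendsto (fun δ : ℝ =>
      (μHE[2 * k]).real (centralSection (compressedSimplex (2 * k + 1) δ)) /
        (μHE[2 * k]).real (facet (compressedSimplex (2 * k + 1) δ) i))
      (𝓝[>] (-1 / (((2 * k + 1 : ℕ) : ℝ) + 1))) (𝓝 (limitRatio k)) := by
  have h1 : Tendsto (fun δ => ((k : ℝ) + 1) * ((1 / 2) ^ k / (k ! : ℕ)) ^ 2 /
      (√(facetGram k δ) / ((2 * k)! : ℕ)))
      (𝓝[>] (-1 / (((2 * k + 1 : ℕ) : ℝ) + 1))) (𝓝 (limitRatio k)) := by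
    have := ((tendsto_facetGram k).sqrt.div_const ((2 * k)! : ℝ))
    rw [Real.sqrt_one] at this
    have h2 := (tendsto_const_nhds (x := ((k : ℝ) + 1) * ((1 / 2) ^ k / (k ! : ℕ)) ^ 2)).div this
      (by positivity)
    rwa [div_div_eq_mul_div, div_one] at h2
  refine h1.congr' ?_
  filter_upwards [self_mem_nhdsWithin] with δ hδ
  have h := (one_add_mul_pos hδ).ne'
  rw [measureReal_def, measureReal_def, centralSection_volume h, facet_volume hk h,
    ENNReal.toReal_ofReal (by positivity), ENNReal.toReal_ofReal (by positivity)]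

theorem not_equilateral_compressedSimplex {k : ℕ} (hk : 1 ≤ k) {δ : ℝ}
    (h : -1 / (((2 * k + 1 : ℕ) : ℝ) + 1) < δ) (h0 : δ < 0) :
    ¬ (compressedSimplex (2 * k + 1) δ).Equilateral := by
  intro he
  have hpos := one_add_mul_pos h
  have hdist : ∀ i j, i ≠ j → dist ((compressedSimplex (2 * k + 1) δ).points i)
      ((compressedSimplex (2 * k + 1) δ).points j) ^ 2 =
      2 + (2 * δ + (((2 * k + 1 : ℕ) : ℝ) + 1) * δ ^ 2) *
        (normal (2 * k + 1) i - normal (2 * k + 1) j) ^ 2 := by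
    intro i j hij
    have hsub := (compressLinear (2 * k + 1) δ).map_sub (EuclideanSpace.single i 1)
      (EuclideanSpace.single j 1)
    simp only [compressLinear_apply] at hsub
    rw [compressedSimplex_points hpos.ne', compressedSimplex_points hpos.ne', dist_eq_norm,
      ← hsub, ← real_inner_self_eq_norm_sq, inner_compress_compress]
    simp only [inner_sub_left, inner_sub_right, inner_single_single, inner_normal_single, hij,
      hij.symm, if_true, if_false]
    ring
  have h1 : (Sum.inl 0 : Fin (k + 1) ⊕ Fin (k + 1)) ≠ Sum.inl (Fin.last k) := by
    simp [Fin.ext_iff]; omega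
  have h2 : (Sum.inl 0 : Fin (k + 1) ⊕ Fin (k + 1)) ≠ Sum.inr 0 := by simp
  have h3 := he.dist_eq ((halves k).injective.ne h1) ((halves k).injective.ne h2)
  have h4 := hdist _ _ ((halves k).injective.ne h1)
  rw [h3, hdist _ _ ((halves k).injective.ne h2)] at h4
  simp only [normal_halves_inl, normal_halves_inr] at h4
  -- Squared edges are `2` within a half and `2 + 4c` across, where `c = δ(2 + (n+1)δ) < 0`.
  nlinarith

theorem equilateral_map {N M n : ℕ} {T : Affine.Simplex ℝ (EuclideanSpace ℝ (Fin M)) n}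
    (f : EuclideanSpace ℝ (Fin M) →ᵃⁱ[ℝ] EuclideanSpace ℝ (Fin N)) (h : T.Equilateral) :
    (T.map f.toAffineMap f.injective).Equilateral := by
  obtain ⟨r, hr⟩ := h
  refine ⟨r, fun i j hij => ?_⟩
  rw [← hr i j hij]
  exact f.dist_map _ _

theorem eventually_largestSectionNotFacet {k : ℕ} (hk : 2 ≤ k) :
    ∀ᶠ δ in 𝓝[>] (-1 / (((2 * k + 1 : ℕ) : ℝ) + 1)),
      ¬ (compressedSimplex (2 * k + 1) δ).Equilateral ∧
        LargestSectionNotFacet (compressedSimplex (2 * k + 1) δ) := by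
  -- One facet suffices, as the volume formula is the same for all.
  have h1 := (tendsto_volume_ratio (by omega : 1 ≤ k) 0).eventually
    (lt_mem_nhds (one_lt_limitRatio hk))
  have hneg : -1 / (((2 * k + 1 : ℕ) : ℝ) + 1) < 0 :=
    div_neg_of_neg_of_pos (by norm_num) (by positivity)
  filter_upwards [h1, self_mem_nhdsWithin, nhdsWithin_le_nhds (gt_mem_nhds hneg)] with δ hδ hδ1 hδ0
  refine ⟨not_equilateral_compressedSimplex (by omega) hδ1 hδ0, ?_⟩
  have h := (one_add_mul_pos hδ1).ne'
  obtain ⟨H, hH, hsub⟩ := exists_isHyperplane_centralSection_subset h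
  refine largestSectionNotFacet_of_facet_lt (by omega) hH fun i => ?_
  refine lt_of_lt_of_le ?_ (measure_mono hsub)
  rw [measureReal_def, measureReal_def, centralSection_volume h, facet_volume (by omega) h,
    ENNReal.toReal_ofReal (by positivity), ENNReal.toReal_ofReal (by positivity)] at hδ
  rw [show 2 * k + 1 - 1 = 2 * k from rfl, centralSection_volume h, facet_volume (by omega) h,
    ENNReal.ofReal_lt_ofReal_iff (by positivity)]
  -- A zero denominator would make the quotient `0`, contradicting that it exceeds `1`.
  have hne : 0 < √(facetGram k δ) / ((2 * k)! : ℕ) := by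
    refine lt_of_le_of_ne (by positivity) fun h0 => ?_
    rw [← h0, div_zero] at hδ
    linarith
  rwa [one_lt_div hne] at hδ

end SimplexSection

end

theorem theorem5 (n : ℕ) (hn : Odd n) (hn5 : 5 ≤ n) :
    (∃ S : Affine.Simplex ℝ (EuclideanSpace ℝ (Fin n)) n,
      ¬ S.Regular ∧ SimplexSection.LargestSectionNotFacet S) ∧
    (∃ S : ℝ → Affine.Simplex ℝ (EuclideanSpace ℝ (Fin (n + 1))) n,
      (∀ δ ∈ Set.Ioc (-1 / ((n : ℝ) + 1)) 0, ∀ j : Fin (n + 1),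
        (S δ).points j = SimplexSection.compress n δ (EuclideanSpace.single j 1)) ∧
      (∀ i : Fin (n + 1),
        Tendsto
          (fun δ : ℝ => (μHE[n - 1]).real (SimplexSection.centralSection (S δ)) /
            (μHE[n - 1]).real (SimplexSection.facet (S δ) i))
          (𝓝[>] (-1 / ((n : ℝ) + 1)))
          (𝓝 (((n : ℝ) + 1) * ((n - 1)! : ℕ) / (2 * (((n - 1)‼ : ℕ) : ℝ) ^ 2)))) ∧
      ∀ᶠ δ in 𝓝[>] (-1 / ((n : ℝ) + 1)),
        ¬ (S δ).Regular ∧ SimplexSection.LargestSectionNotFacet (S δ)) ∧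
    1 < ((n : ℝ) + 1) * ((n - 1)! : ℕ) / (2 * (((n - 1)‼ : ℕ) : ℝ) ^ 2) := by
  obtain ⟨k, rfl⟩ := hn
  have hk : 2 ≤ k := by omega
  have hev := SimplexSection.eventually_largestSectionNotFacet hk
  rw [show 2 * k + 1 - 1 = 2 * k from rfl, ← SimplexSection.limitRatio_eq]
  refine ⟨?_, ⟨SimplexSection.compressedSimplex (2 * k + 1), fun δ hδ j => ?_, fun i => ?_, ?_⟩,
    SimplexSection.one_lt_limitRatio hk⟩
  -- For (a), any admissible `δ` works; a regular copy in `ℝⁿ` would make the compressed simplex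
  -- equilateral.
  · obtain ⟨δ, hne, hlarge⟩ := hev.exists
    obtain ⟨T, f, hT⟩ := SimplexSection.exists_map_eq (SimplexSection.compressedSimplex _ δ)
    refine ⟨T, fun h => hne ?_, hlarge.of_map (by omega) f hT⟩
    rw [hT]
    exact SimplexSection.equilateral_map f h.equilateral
  · exact SimplexSection.compressedSimplex_points (SimplexSection.one_add_mul_pos hδ.1).ne' j
  · exact SimplexSection.tendsto_volume_ratio (by omega) i
  · exact hev.mono fun δ h => ⟨fun hr => h.1 hr.equilateral, h.2⟩
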